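/- **Setting.** There are $n$ applicants and $n$ institutions. A type of an applicant is a strict ranking of some subset of the institutions (her preference list of acceptable institutions); the set $\mathcal T_a$ of possible types of applicant $a$ may be any set of such lists (for instance all lists, or all complete lists). Each institution $h$ has a strict priority order $\succ_h$ over all applicants. An outcome is a partial one-to-one matching. *Top Trading Cycles* (TTC) repeats the following until every applicant is matched or has exhausted her list: each remaining applicant (unmatched, list not exhausted) points to her favorite remaining institution, each remaining institution points to its highest-priority remaining applicant, and some cycle of this graph is executed (each applicant on it is permanently matched to the institution she points to). The *menu* of applicant $i$ at a type profile $t$ is the set of all matches (institutions, or "unmatched") that $i$ can receive when the types $t_{-i}$ of the others are fixed and her own type ranges over $\mathcal T_i$. An *extensive-form outcome description* of a social choice function $f$ is a finite directed graph with a single source, whose vertices are organized in layers $1,\dots,L$, with edges only from a layer to the next one. Each vertex $v$ of out-degree at least $2$ queries one applicant $a$ and has a transition function from $\mathcal T_a$ to the edges leaving $v$; other vertices query nobody. A type profile $t$ determines an evaluation path from the source to a sink, and the sinks are labeled by outcomes so that the sink reached on $t$ is labeled $f(t)$. It is an *individualized dictatorship description* for applicant $i$ if for some layer $k$, every vertex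 in a layer before $k$ queries some applicant other than $i$, and every vertex $v$ in layer $k$ queries $i$ and is labeled by a set that equals the menu of $i$ at every profile whose evaluation path visits $v$. It is *applicant-proposing* if on every evaluation path, for every applicant $a$ and every $j$, the transition function at the $j$-th vertex that queries $a$ depends only on the $j$-th institution on $a$'s list ("empty" if the list is shorter). Its *memory* is $\log_2$ of the maximum number of vertices in a layer. **Theorem.** There is a function $B(n)=\widetilde{O}(n)$ (that is, $B(n)=O(n\log^k n)$ for some constant $k$) such that for every $n$, all type sets, all priorities and every applicant $i$, TTC has an applicant-proposing individualized dictatorship description for $i$ with memory at most $B(n)$; that is, TTC has an applicant-linear individualized dictatorship description for each applicant. Moreover, fix a type profile and start TTC by executing, for as long as possible, only cycles that do not involve $i$, where $i$ stays in the market during this stage (institutions may point to her) whatever her list is. Let $R$ be the set of institutions that remain, and $\mu$ the partial matching reached. Then $i$'s menu consists of the favorites in $R$ ("unmatched" if no institution of $R$ is acceptable) of all types in $\mathcal T_i$. In particular it is $R$ together with "unmatched" if $\mathcal T_i$ contains all lists, and it is $R$ if $\mathcal T_i$ is the set of complete lists. Continuing TTC from $\mu$, executing cycles in any order, yields the TTC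 matching. -/

import Mathlib

/-! ### Matching environments -/

/-- A type of an applicant: a strict ranking (from favorite to least favorite) of some subset of
the institutions, the acceptable ones. -/
def PrefList (H : Type) : Type := {l : List H // l.Nodup}

/-- A partial one-to-one matching of applicants to institutions. -/
@[ext] structure Matching (A H : Type) where
  /-- The institution that an applicant is matched to, `none` if she is unmatched. -/
  inst : A → Option H
  one_to_one : ∀ a b h, inst a = some h → inst b = some h → a = b

/-- The matching in which everyone is unmatched. -/
def Matching.empty (A H : Type) : Matching A H where
  inst := fun _ => none
  one_to_one := by intro a b h hh; simp at hh

/-! ### Top Trading Cycles -/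

section TTC

variable {A H : Type} [Fintype A] [DecidableEq A] [Fintype H] [DecidableEq H]

/-- The remaining (not yet matched) institutions. -/
def Matching.freeInst (μ : Matching A H) : Finset H :=
  Finset.univ.filter fun h => ∀ a, μ.inst a ≠ some h

/-- The highest ranked institution of `R` on the list `l`, `none` if no institution of `R` is
on the list. -/
def favorite (l : PrefList H) (R : Finset H) : Option H :=
  l.1.find? fun h => decide (h ∈ R)

/-- The remaining applicants: those who are not yet matched and have not exhausted their
preference lists. -/
def activeApplicants (t : A → PrefList H) (μ : Matching A H) : Finset A :=
  Finset.univ.filter fun a => μ.inst a = none ∧ favorite (t a) μ.freeInst ≠ none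

/-- Among the applicants in `S`, applicant `a` has the highest priority at `h` (larger in the
linear order `P h` means higher priority). -/
def IsTopPriority (P : H → LinearOrder A) (S : Finset A) (h : H) (a : A) : Prop :=
  a ∈ S ∧ ∀ b ∈ S, (P h).le b a

/-- A trading cycle `c 0 → p 0 → c 1 → p 1 → ⋯ → c k → p k → c 0` (indices are taken modulo
`k + 1`) in the pointing graph on the applicants in `S` and the institutions in `R`: each
applicant points to her favorite institution in `R`, and each institution points to its highest
priority applicant in `S`. -/
structure IsTradingCycle (P : H → LinearOrder A) (t : A → PrefList H) (R : Finset H)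
    (S : Finset A) {k : ℕ} (c : Fin (k + 1) → A) (p : Fin (k + 1) → H) : Prop where
  injective : Function.Injective c
  mem : ∀ j, c j ∈ S
  applicant_points : ∀ j, favorite (t (c j)) R = some (p j)
  institution_points : ∀ j, IsTopPriority P S (p j) (c (j + 1))

/-- `ν` arises from `μ` by matching each applicant `c j` to `p j`. -/
def Executes (μ ν : Matching A H) {k : ℕ} (c : Fin (k + 1) → A) (p : Fin (k + 1) → H) : Prop :=
  (∀ j, ν.inst (c j) = some (p j)) ∧ ∀ a, a ∉ Set.range c → ν.inst a = μ.inst a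

/-- One iteration of Top Trading Cycles: some cycle among the remaining applicants and
institutions is executed. -/
def TTCStep (P : H → LinearOrder A) (t : A → PrefList H) (μ ν : Matching A H) : Prop :=
  ∃ (k : ℕ) (c : Fin (k + 1) → A) (p : Fin (k + 1) → H),
    IsTradingCycle P t μ.freeInst (activeApplicants t μ) c p ∧ Executes μ ν c p

/-- `ν` can be the final matching of Top Trading Cycles when it is started from the partial
matching `μ`: iterate until everyone is matched or has exhausted her preference list. -/
def TTCRun (P : H → LinearOrder A) (t : A → PrefList H) (μ ν : Matching A H) : Prop :=
  Relation.ReflTransGen (TTCStep P t) μ ν ∧ activeApplicants t ν = ∅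

theorem exists_ttcStep (P : H → LinearOrder A) (t : A → PrefList H) (μ : Matching A H)
    (hne : (activeApplicants t μ).Nonempty) : ∃ ν, TTCStep P t μ ν := by
  classical
  set S := activeApplicants t μ with hS
  set R := μ.freeInst with hR
  have hfav : ∀ a : S, ∃ h, favorite (t a) R = some h := by
    intro a
    have hmem : (a : A) ∈ activeApplicants t μ := a.2
    rw [activeApplicants, Finset.mem_filter] at hmem
    exact Option.ne_none_iff_exists'.mp hmem.2.2
  choose q hq using hfav
  have htop : ∀ h, ∃ a : S, IsTopPriority P S h a := by
    intro h
    let _ := P h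
    obtain ⟨a, ha, hmax⟩ := S.exists_max_image id hne
    exact ⟨⟨a, ha⟩, ha, hmax⟩
  choose top htop using htop
  let F : S → S := fun a => top (q a)
  obtain ⟨x, hx⟩ := hne
  obtain ⟨m, n, hmn, hF⟩ :=
    Finite.exists_ne_map_eq_of_infinite (fun m : ℕ => F^[m] ⟨x, hx⟩)
  have key : ∃ y : S, y ∈ Function.periodicPts F := by
    wlog hlt : m < n generalizing m n
    · exact this n m hmn.symm hF.symm (lt_of_le_of_ne (not_lt.mp hlt) hmn.symm)
    refine ⟨F^[m] ⟨x, hx⟩, n - m, by omega, ?_⟩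
    have h2 : F^[n - m] (F^[m] ⟨x, hx⟩) = F^[n] ⟨x, hx⟩ := by
      rw [← Function.iterate_add_apply, Nat.sub_add_cancel hlt.le]
    exact h2.trans hF.symm
  obtain ⟨y, hy⟩ := key
  obtain ⟨k, hk⟩ : ∃ k, Function.minimalPeriod F y = k + 1 :=
    ⟨_, (Nat.succ_pred_eq_of_pos (Function.minimalPeriod_pos_of_mem_periodicPts hy)).symm⟩
  let c : Fin (k + 1) → S := fun j => F^[j] y
  have hcinj : Function.Injective c := by
    intro i j hij
    apply Fin.ext
    exact Function.iterate_injOn_Iio_minimalPeriod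
      (by rw [Set.mem_Iio, hk]; exact i.2) (by rw [Set.mem_Iio, hk]; exact j.2) hij
  have hcsucc : ∀ j, c (j + 1) = F (c j) := by
    intro j
    have h1 : ((j + 1 : Fin (k + 1)) : ℕ) = (j + 1) % (k + 1) := by
      simp [Fin.val_add]
    change F^[((j + 1 : Fin (k + 1)) : ℕ)] y = F (F^[j] y)
    have h2 := Function.iterate_mod_minimalPeriod_eq (f := F) (x := y) (n := (j : ℕ) + 1)
    rw [hk] at h2
    rw [h1, h2, Function.iterate_succ_apply']
  have hcyc : IsTradingCycle P t R S (fun j => (c j : A)) (fun j => q (c j)) :=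
    { injective := Subtype.val_injective.comp hcinj
      mem := fun j => (c j).2
      applicant_points := fun j => hq (c j)
      institution_points := fun j => by
        have := htop (q (c j))
        rw [hcsucc]
        exact this }
  have hinR : ∀ (a : A) (h : H), favorite (t a) R = some h → h ∈ R := by
    intro a h hh
    simpa using List.find?_some hh
  have hfree : ∀ h ∈ R, ∀ a, μ.inst a ≠ some h := by
    intro h hh
    rw [hR, Matching.freeInst, Finset.mem_filter] at hh
    exact hh.2
  let ν : Matching A H :=
    { inst := fun a => if a ∈ Set.range (fun j => (c j : A)) then favorite (t a) R
        else μ.inst a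
      one_to_one := by
        intro a b h ha hb
        by_cases h1 : a ∈ Set.range (fun j => (c j : A)) <;>
          by_cases h2 : b ∈ Set.range (fun j => (c j : A))
        · rw [if_pos h1] at ha
          rw [if_pos h2] at hb
          obtain ⟨i, rfl⟩ := h1
          obtain ⟨j, rfl⟩ := h2
          have e1 : q (c i) = h := Option.some.inj ((hq (c i)).symm.trans ha)
          have e2 : q (c j) = h := Option.some.inj ((hq (c j)).symm.trans hb)
          have e3 : c (i + 1) = c (j + 1) := by
            rw [hcsucc, hcsucc]; simp only [F, e1, e2]
          have e4 := add_right_cancel (hcinj e3)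
          rw [e4]
        · rw [if_pos h1] at ha
          rw [if_neg h2] at hb
          exact absurd hb (hfree h (hinR a h ha) b)
        · rw [if_neg h1] at ha
          rw [if_pos h2] at hb
          exact absurd ha (hfree h (hinR b h hb) a)
        · rw [if_neg h1] at ha
          rw [if_neg h2] at hb
          exact μ.one_to_one a b h ha hb }
  refine ⟨ν, k, _, _, hcyc, ?_, ?_⟩
  · intro j
    change (if (c j : A) ∈ Set.range (fun j => (c j : A)) then favorite (t (c j)) R
      else μ.inst (c j)) = some (q (c j))
    rw [if_pos ⟨j, rfl⟩]
    exact hq (c j)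
  · intro a ha
    exact if_neg ha

theorem exists_ttcRun (P : H → LinearOrder A) (t : A → PrefList H) (μ : Matching A H) :
    ∃ ν, TTCRun P t μ ν := by
  induction hN : (Finset.univ.filter fun a => μ.inst a = none).card using Nat.strong_induction_on
    generalizing μ with
  | _ N ih =>
    rcases (activeApplicants t μ).eq_empty_or_nonempty with h | h
    · exact ⟨μ, Relation.ReflTransGen.refl, h⟩
    · obtain ⟨ν, hν⟩ := exists_ttcStep P t μ h
      have hlt : (Finset.univ.filter fun a => ν.inst a = none).card < N := by
        rw [← hN]
        obtain ⟨k, c, p, hc, he1, he2⟩ := hν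
        apply Finset.card_lt_card
        rw [Finset.ssubset_iff_of_subset]
        · refine ⟨c 0, ?_, ?_⟩
          · have := hc.mem 0
            rw [activeApplicants, Finset.mem_filter] at this
            simp [this.2.1]
          · simp [he1 0]
        · intro a ha
          rw [Finset.mem_filter] at ha ⊢
          refine ⟨ha.1, ?_⟩
          by_cases hr : a ∈ Set.range c
          · obtain ⟨j, rfl⟩ := hr
            rw [he1 j] at ha
            simp at ha
          · rw [← he2 a hr]
            exact ha.2
      obtain ⟨ξ, hξ, hξ'⟩ := ih _ hlt ν rfl
      exact ⟨ξ, Relation.ReflTransGen.head hν hξ, hξ'⟩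

/-- The social choice function of Top Trading Cycles: the final matching of a run of the
procedure, where the cycles may be executed in an arbitrary order. -/
noncomputable def ttc (P : H → LinearOrder A) (t : A → PrefList H) : Matching A H :=
  (exists_ttcRun P t (Matching.empty A H)).choose

/-- Top Trading Cycles in the matching environment in which `𝒯 a` is the set of types of
applicant `a`. -/
noncomputable def ttcOn (P : H → LinearOrder A) (𝒯 : A → Set (PrefList H))
    (t : (a : A) → 𝒯 a) : Matching A H :=
  ttc P fun a => (t a).1

/-- One iteration of Top Trading Cycles while applicant `i` stays in the market without pointing
to any institution: some cycle that does not involve `i` is executed. -/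
def TTCStepWithout (P : H → LinearOrder A) (i : A) (t : A → PrefList H)
    (μ ν : Matching A H) : Prop :=
  ∃ (k : ℕ) (c : Fin (k + 1) → A) (p : Fin (k + 1) → H),
    IsTradingCycle P t μ.freeInst (insert i (activeApplicants t μ)) c p ∧ (∀ j, c j ≠ i) ∧
      Executes μ ν c p

/-- `μ` arises from the empty matching by executing cycles that do not involve `i` for as long as
there are any. -/
def TTCRunWithout (P : H → LinearOrder A) (i : A) (t : A → PrefList H)
    (μ : Matching A H) : Prop :=
  Relation.ReflTransGen (TTCStepWithout P i t) (Matching.empty A H) μ ∧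
    ∀ ν, ¬ TTCStepWithout P i t μ ν

end TTC

/-! ### Extensive-form descriptions -/

/-- An extensive-form description for the players in `ι`, where `T i` is the set of types of
player `i`. An edge is identified with the vertex it leads to. -/
structure ExtensiveFormDescription (ι : Type) (T : ι → Type) where
  /-- The vertices. -/
  V : Type
  [fintypeV : Fintype V]
  /-- The number of layers. -/
  L : ℕ
  /-- The layer of a vertex. -/
  layer : V → ℕ
  layer_mem : ∀ v, layer v ∈ Finset.Icc 1 L
  /-- The out-neighbors of a vertex. -/
  succ : V → Finset V
  layer_succ : ∀ v, ∀ w ∈ succ v, layer w = layer v + 1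
  /-- The source. -/
  source : V
  layer_source : layer source = 1
  source_unique : ∀ v, v ≠ source → ∃ u, v ∈ succ u
  /-- The player queried at a vertex, if there is one. -/
  query : V → Option ι
  query_isSome_iff : ∀ v, (query v).isSome ↔ 2 ≤ (succ v).card
  /-- If `v` queries player `i`, then `next v i` is the transition function of `v`. -/
  next : V → (i : ι) → T i → V
  next_mem : ∀ v i, query v = some i → ∀ x, next v i x ∈ succ v

attribute [instance] ExtensiveFormDescription.fintypeV

namespace ExtensiveFormDescription

variable {ι : Type} {T : ι → Type} (D : ExtensiveFormDescription ι T)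

/-- On the type profile `t`, the evaluation path moves from `v` to `w`. -/
def Step (t : (i : ι) → T i) (v w : D.V) : Prop :=
  w ∈ D.succ v ∧ ∀ i, D.query v = some i → w = D.next v i (t i)

/-- `D.Visits t v m`: the evaluation path on `t` visits `v`, and for each player `i`, exactly
`m i` vertices strictly before `v` on this path query player `i`. -/
inductive Visits [DecidableEq ι] (t : (i : ι) → T i) : D.V → (ι → ℕ) → Prop
  | source : Visits t D.source (fun _ => 0)
  | step {v w : D.V} {m : ι → ℕ} : Visits t v m → D.Step t v w →
      Visits t w (fun i => m i + if D.query v = some i then 1 else 0)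

/-- The vertex `v` is on the evaluation path on `t`. -/
def OnPath (t : (i : ι) → T i) (v : D.V) : Prop :=
  Relation.ReflTransGen (D.Step t) D.source v

/-- The sinks can be labeled by outcomes such that on each type profile `t`, the sink that is
reached is labeled by `f t`. -/
def IsOutcomeDescription {Ω : Type} (f : ((i : ι) → T i) → Ω) : Prop :=
  ∃ label : D.V → Ω, ∀ t v, D.OnPath t v → D.succ v = ∅ → label v = f t

/-- The memory requirement: the base 2 logarithm of the maximal number of vertices in a layer. -/
noncomputable def memory : ℝ :=
  Real.logb 2 (((Finset.Icc 1 D.L).sup fun j =>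
    (Finset.univ.filter fun v => D.layer v = j).card : ℕ) : ℝ)

end ExtensiveFormDescription

/-- The menu of applicant `i` with respect to the types `t j`, `j ≠ i`, in the social choice
function `f`. The `i`-outcome of a matching is identified with the institution that `i` is matched
to (`none` if she is unmatched). -/
def menu {A H : Type} [DecidableEq A] {T : A → Type} (f : ((a : A) → T a) → Matching A H)
    (i : A) (t : (a : A) → T a) : Set (Option H) :=
  {o | ∃ x : T i, (f (Function.update t i x)).inst i = o}

namespace ExtensiveFormDescription

/-- `D` is an individualized dictatorship description of `f` for applicant `i`. -/
def IsIndividualizedDictatorship {A H : Type} [DecidableEq A] {T : A → Type}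
    (D : ExtensiveFormDescription A T) (f : ((a : A) → T a) → Matching A H) (i : A) : Prop :=
  D.IsOutcomeDescription f ∧
    ∃ k ∈ Finset.Icc 1 D.L,
      (∀ v, D.layer v < k → ∃ a, a ≠ i ∧ D.query v = some a) ∧
      (∀ v, D.layer v = k → D.query v = some i) ∧
      ∃ M : D.V → Set (Option H),
        ∀ v, D.layer v = k → ∀ t, D.OnPath t v → M v = menu f i t

/-- `D` is applicant-proposing: at the `j`-th vertex of an evaluation path that queries applicant
`i`, the transition function depends only on the `j`-th institution on the preference list of `i`
(`none` if the list is shorter). Here `j = m i + 1`, which is position `m i` of the list, counted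
from `0`. -/
def IsApplicantProposing {A H : Type} [DecidableEq A] {𝒯 : A → Set (PrefList H)}
    (D : ExtensiveFormDescription A fun a => 𝒯 a) : Prop :=
  ∀ t v m, D.Visits t v m → ∀ i, D.query v = some i →
    ∀ x y : 𝒯 i, x.1.1[m i]? = y.1.1[m i]? → D.next v i x = D.next v i y

end ExtensiveFormDescription

/-- `f = Õ(g)`: big O up to logarithmic factors. -/
def IsSoftO (f g : ℕ → ℝ) : Prop :=
  ∃ k : ℕ, f =O[Filter.atTop] fun n => g n * Real.log (g n) ^ k

/-! The order of cycles does not matter in TTC: in the pointing graph every vertex has at most one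
out-edge, so two distinct cycles are disjoint, and executing one leaves the other intact
(`TTCStep.diamond`). By Church-Rosser all runs end in the same matching (`TTCRun.unique`), so the
cycles avoiding `i` may be executed early. Those cycles do not depend on the list of `i`. Once none
is left, either `i` finds nothing acceptable or every remaining cycle passes through `i` and gives
her the favorite free institution (`TTCRunWithout.ttc_inst_self`). This yields the menu
(`menu_ttcOn`).

For the description, TTC is run as a streaming algorithm that reads lists one entry at a time. An
entry whose institution has been taken can be forgotten, so one entry per applicant, the partial
matching and the reading positions suffice, at a cost of O(log n) bits per applicant.

The difficulty is that the menu must appear at one fixed layer, with every earlier layer querying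
someone other than `i`, although the number of useful reads depends on the profile. Padding reads
are needed, and a padding read must not lose an unprocessed entry. Hence an auxiliary applicant `d`
has her whole list read and stored at the outset and absorbs the padding; after the menu layer, `i`
plays this role. Storing two complete lists adds only O(n log n) bits. A potential counting unread
entries and unmatched applicants bounds each simulated phase (`SimState.Simulates.iterate`), and
`ListReader.description` turns the algorithm into a layered graph. -/

set_option linter.unusedSectionVars false

/-! ### Order independence of Top Trading Cycles -/

section TTCTheory

variable {A H : Type} [Fintype A] [DecidableEq A] [Fintype H] [DecidableEq H]

theorem favorite_mem {l : PrefList H} {R : Finset H} {h : H} (hl : favorite l R = some h) :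
    h ∈ R := by
  simpa using List.find?_some hl

theorem favorite_eq_none_iff {l : PrefList H} {R : Finset H} :
    favorite l R = none ↔ ∀ h ∈ l.1, h ∉ R := by
  simp [favorite, List.find?_eq_none]

theorem favorite_mono {l : PrefList H} {R R' : Finset H} {h : H} (hl : favorite l R = some h)
    (hR : R' ⊆ R) (hh : h ∈ R') : favorite l R' = some h := by
  rw [favorite, List.find?_eq_some_iff_append] at hl ⊢
  obtain ⟨-, as, bs, e, has⟩ := hl
  refine ⟨by simpa using hh, as, bs, e, fun a ha => ?_⟩
  have := has a ha
  simp only [Bool.not_eq_true', decide_eq_false_iff_not] at this ⊢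
  exact fun h' => this (hR h')

theorem favorite_eq_none_mono {l : PrefList H} {R R' : Finset H} (hl : favorite l R = none)
    (hR : R' ⊆ R) : favorite l R' = none :=
  favorite_eq_none_iff.2 fun h hh h' => favorite_eq_none_iff.1 hl h hh (hR h')

theorem Matching.mem_freeInst {μ : Matching A H} {h : H} :
    h ∈ μ.freeInst ↔ ∀ a, μ.inst a ≠ some h := by
  simp [Matching.freeInst]

theorem mem_activeApplicants {t : A → PrefList H} {μ : Matching A H} {a : A} :
    a ∈ activeApplicants t μ ↔ μ.inst a = none ∧ favorite (t a) μ.freeInst ≠ none := by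
  simp [activeApplicants]

/-- Everyone who is matched in `μ` has the same match in `ν`. -/
def Matching.Extends (μ ν : Matching A H) : Prop :=
  ∀ a h, μ.inst a = some h → ν.inst a = some h

theorem Matching.Extends.freeInst_subset {μ ν : Matching A H} (hμ : μ.Extends ν) :
    ν.freeInst ⊆ μ.freeInst := by
  intro h hh
  rw [Matching.mem_freeInst] at hh ⊢
  exact fun a ha => hh a (hμ a h ha)

theorem Matching.Extends.inst_eq_none {μ ν : Matching A H} (hμ : μ.Extends ν) {a : A}
    (ha : ν.inst a = none) : μ.inst a = none := by
  cases h : μ.inst a with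
  | none => rfl
  | some b => simp [hμ a b h] at ha

theorem Matching.Extends.activeApplicants_subset {μ ν : Matching A H} (hμ : μ.Extends ν)
    (t : A → PrefList H) : activeApplicants t ν ⊆ activeApplicants t μ := by
  intro a ha
  rw [mem_activeApplicants] at ha ⊢
  exact ⟨hμ.inst_eq_none ha.1, fun h => ha.2 (favorite_eq_none_mono h hμ.freeInst_subset)⟩

theorem Matching.extends_of_reflTransGen {r : Matching A H → Matching A H → Prop}
    (hr : ∀ μ ν, r μ ν → μ.Extends ν) {μ ν : Matching A H} (h : Relation.ReflTransGen r μ ν) :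
    μ.Extends ν := by
  induction h with
  | refl => exact fun _ _ h => h
  | tail _ hs ih => exact fun a h ha => hr _ _ hs a h (ih a h ha)

theorem IsTopPriority.eq {P : H → LinearOrder A} {S : Finset A} {h : H} {a b : A}
    (ha : IsTopPriority P S h a) (hb : IsTopPriority P S h b) : a = b :=
  (P h).le_antisymm a b (hb.2 a ha.1) (ha.2 b hb.1)

theorem IsTopPriority.mono {P : H → LinearOrder A} {S S' : Finset A} {h : H} {a : A}
    (ha : IsTopPriority P S h a) (hS : S' ⊆ S) (ha' : a ∈ S') : IsTopPriority P S' h a :=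
  ⟨ha', fun b hb => ha.2 b (hS hb)⟩

/-- An institution determines the applicant it points to, and these applicants are distinct along
the cycle. -/
theorem IsTradingCycle.institutions_injective {P : H → LinearOrder A} {t : A → PrefList H}
    {R : Finset H} {S : Finset A} {k : ℕ} {c : Fin (k + 1) → A} {p : Fin (k + 1) → H}
    (hc : IsTradingCycle P t R S c p) : Function.Injective p := by
  intro j j' hj
  have h1 := hc.institution_points j
  rw [hj] at h1
  exact add_right_cancel (hc.injective (h1.eq (hc.institution_points j')))

theorem IsTradingCycle.exists_executes {P : H → LinearOrder A} {t : A → PrefList H}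
    {μ : Matching A H} {S : Finset A} {k : ℕ} {c : Fin (k + 1) → A} {p : Fin (k + 1) → H}
    (hc : IsTradingCycle P t μ.freeInst S c p) : ∃ ν, Executes μ ν c p := by
  classical
  have hfree : ∀ j a, μ.inst a ≠ some (p j) := fun j =>
    Matching.mem_freeInst.1 (favorite_mem (hc.applicant_points j))
  refine ⟨⟨fun a => if a ∈ Set.range c then favorite (t a) μ.freeInst else μ.inst a, ?_⟩,
    fun j => ?_, fun a ha => if_neg ha⟩
  · intro a b h ha hb
    split_ifs at ha hb with h1 h2 h2
    · obtain ⟨i, rfl⟩ := h1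
      obtain ⟨j, rfl⟩ := h2
      rw [hc.applicant_points, ← hb, hc.applicant_points] at ha
      rw [hc.institutions_injective (Option.some.inj ha)]
    · obtain ⟨i, rfl⟩ := h1
      rw [hc.applicant_points, ← hb] at ha
      exact absurd ha.symm (hfree i b)
    · obtain ⟨i, rfl⟩ := h2
      rw [hc.applicant_points, ← ha] at hb
      exact absurd hb.symm (hfree i a)
    · exact μ.one_to_one a b h ha hb
  · exact (if_pos ⟨j, rfl⟩).trans (hc.applicant_points j)

theorem Executes.extends {μ ν : Matching A H} {k : ℕ} {c : Fin (k + 1) → A} {p : Fin (k + 1) → H}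
    (he : Executes μ ν c p) (hμ : ∀ j, μ.inst (c j) = none) : μ.Extends ν := by
  intro a h ha
  by_cases hr : a ∈ Set.range c
  · obtain ⟨j, rfl⟩ := hr
    simp [hμ j] at ha
  · rw [he.2 a hr, ha]

-- Successors in the pointing graph are unique, so from a common applicant onwards the first cycle
-- follows the second. Applied in both directions, this shows that cycles that meet have the same
-- applicants.
open scoped Fin.NatCast Fin.CommRing in
theorem IsTradingCycle.range_subset {P : H → LinearOrder A} {t : A → PrefList H}
    {R : Finset H} {S : Finset A} {k k' : ℕ} {c : Fin (k + 1) → A} {p : Fin (k + 1) → H}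
    {c' : Fin (k' + 1) → A} {p' : Fin (k' + 1) → H} (hc : IsTradingCycle P t R S c p)
    (hc' : IsTradingCycle P t R S c' p') {j : Fin (k + 1)} (hj : c j ∈ Set.range c') :
    Set.range c ⊆ Set.range c' := by
  have hstep : ∀ x, c x ∈ Set.range c' → c (x + 1) ∈ Set.range c' := by
    rintro x ⟨y, hy⟩
    refine ⟨y + 1, ?_⟩
    have h1 := hc'.applicant_points y
    rw [hy, hc.applicant_points x] at h1
    have h2 := hc'.institution_points y
    rw [← Option.some.inj h1] at h2
    exact h2.eq (hc.institution_points x)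
  have hall : ∀ m : ℕ, c (j + (m : Fin (k + 1))) ∈ Set.range c' := by
    intro m
    induction m with
    | zero => simpa using hj
    | succ m ih =>
      rw [Nat.cast_succ, ← add_assoc]
      exact hstep _ ih
  rintro _ ⟨x, rfl⟩
  have := hall (x - j : Fin (k + 1)).val
  rwa [Fin.cast_val_eq_self, add_sub_cancel] at this

/-- The institutions of `c'` stay free, since an institution shared with `c` would point to a shared
applicant. Favorites and top priorities that survive a shrinking of the market remain favorites and
top priorities. -/
theorem IsTradingCycle.of_disjoint {P : H → LinearOrder A} {t : A → PrefList H}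
    {μ ν : Matching A H} {k k' : ℕ} {c : Fin (k + 1) → A} {p : Fin (k + 1) → H}
    {c' : Fin (k' + 1) → A} {p' : Fin (k' + 1) → H}
    (hc : IsTradingCycle P t μ.freeInst (activeApplicants t μ) c p) (he : Executes μ ν c p)
    (hc' : IsTradingCycle P t μ.freeInst (activeApplicants t μ) c' p')
    (hd : ∀ j, c' j ∉ Set.range c) :
    IsTradingCycle P t ν.freeInst (activeApplicants t ν) c' p' := by
  have hext : μ.Extends ν :=
    he.extends fun j =>
      (mem_activeApplicants.1 (hc.mem j)).1
  have hfree : ∀ j, p' j ∈ ν.freeInst := by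
    intro j
    rw [Matching.mem_freeInst]
    intro a ha
    by_cases hr : a ∈ Set.range c
    · obtain ⟨m, rfl⟩ := hr
      rw [he.1 m] at ha
      have h1 := hc.institution_points m
      rw [Option.some.inj ha] at h1
      exact hd (j + 1) ⟨m + 1, h1.eq (hc'.institution_points j)⟩
    · rw [he.2 a hr] at ha
      exact Matching.mem_freeInst.1 (favorite_mem (hc'.applicant_points j)) a ha
  have hpt : ∀ j, favorite (t (c' j)) ν.freeInst = some (p' j) := fun j =>
    favorite_mono (hc'.applicant_points j) hext.freeInst_subset (hfree j)
  have hmem : ∀ j, c' j ∈ activeApplicants t ν := by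
    intro j
    rw [mem_activeApplicants, hpt, he.2 _ (hd j)]
    exact ⟨(mem_activeApplicants.1 (hc'.mem j)).1, by simp⟩
  exact ⟨hc'.injective, hmem, hpt, fun j =>
    (hc'.institution_points j).mono (hext.activeApplicants_subset t) (hmem _)⟩

theorem TTCStep.extends {P : H → LinearOrder A} {t : A → PrefList H} {μ ν : Matching A H}
    (h : TTCStep P t μ ν) : μ.Extends ν := by
  obtain ⟨k, c, p, hc, he⟩ := h
  exact he.extends fun j =>
    (mem_activeApplicants.1 (hc.mem j)).1

theorem TTCStep.diamond {P : H → LinearOrder A} {t : A → PrefList H} {μ ν₁ ν₂ : Matching A H}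
    (h₁ : TTCStep P t μ ν₁) (h₂ : TTCStep P t μ ν₂) :
    ν₁ = ν₂ ∨ ∃ ξ, TTCStep P t ν₁ ξ ∧ TTCStep P t ν₂ ξ := by
  obtain ⟨k, c, p, hc, he⟩ := h₁
  obtain ⟨k', c', p', hc', he'⟩ := h₂
  by_cases hd : ∃ j, c j ∈ Set.range c'
  · left
    obtain ⟨j, hj⟩ := hd
    obtain ⟨j', hj'⟩ := id hj
    have hr : Set.range c = Set.range c' :=
      (hc.range_subset hc' hj).antisymm (hc'.range_subset hc (j := j') (hj' ▸ ⟨j, rfl⟩))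
    ext1
    funext a
    by_cases ha : a ∈ Set.range c
    · obtain ⟨m', hm'⟩ := hr ▸ ha
      obtain ⟨m, rfl⟩ := ha
      have h1 := he'.1 m'
      have h2 := hc'.applicant_points m'
      rw [hm'] at h1 h2
      rw [he.1, h1, ← h2, hc.applicant_points]
    · rw [he.2 a ha, he'.2 a (hr ▸ ha)]
  · right
    push Not at hd
    have hd' : ∀ j, c' j ∉ Set.range c := by
      rintro j ⟨m, hm⟩
      exact hd m ⟨j, hm.symm⟩
    have hc1 := hc.of_disjoint he hc' hd'
    have hc2 := hc'.of_disjoint he' hc hd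
    obtain ⟨ξ, hξ⟩ := hc1.exists_executes
    refine ⟨ξ, ⟨k', c', p', hc1, hξ⟩, k, c, p, hc2, fun j => ?_, fun a ha => ?_⟩
    · rw [hξ.2 _ (hd j), he.1]
    · by_cases ha' : a ∈ Set.range c'
      · obtain ⟨m, rfl⟩ := ha'
        rw [hξ.1, he'.1]
      · rw [hξ.2 _ ha', he.2 _ ha, he'.2 _ ha']

theorem not_ttcStep_of_activeApplicants_eq_empty {P : H → LinearOrder A} {t : A → PrefList H}
    {μ ν : Matching A H} (h : activeApplicants t μ = ∅) : ¬ TTCStep P t μ ν := by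
  rintro ⟨k, c, p, hc, -⟩
  simpa [h] using hc.mem 0

/-- The diamond property gives a common descendant of the two final matchings, and a final matching
admits no further step. -/
theorem TTCRun.unique {P : H → LinearOrder A} {t : A → PrefList H} {μ ν₁ ν₂ : Matching A H}
    (h₁ : TTCRun P t μ ν₁) (h₂ : TTCRun P t μ ν₂) : ν₁ = ν₂ := by
  have hcr := Relation.church_rosser (r := TTCStep P t) (fun a b c hab hac => by
    rcases hab.diamond hac with rfl | ⟨ξ, hb, hc⟩
    · exact ⟨b, .refl, .refl⟩
    · exact ⟨ξ, .single hb, .single hc⟩) h₁.1 h₂.1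
  obtain ⟨ξ, hξ₁, hξ₂⟩ := hcr
  have key : ∀ ν, TTCRun P t μ ν → Relation.ReflTransGen (TTCStep P t) ν ξ → ν = ξ := by
    intro ν hν hs
    rcases hs.cases_head with h | ⟨η, hη, -⟩
    · exact h
    · exact absurd hη (not_ttcStep_of_activeApplicants_eq_empty hν.2)
  exact (key _ h₁ hξ₁).trans (key _ h₂ hξ₂).symm

theorem TTCRun.eq_ttc {P : H → LinearOrder A} {t : A → PrefList H} {μ ν : Matching A H}
    (hμ : Relation.ReflTransGen (TTCStep P t) (Matching.empty A H) μ) (hν : TTCRun P t μ ν) :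
    ν = ttc P t :=
  TTCRun.unique ⟨hμ.trans hν.1, hν.2⟩ (exists_ttcRun P t (Matching.empty A H)).choose_spec

/-! ### Cycles avoiding one applicant, and her menu -/

/-- Institutions on the cycle do not point to `i`, so they keep their top applicant even if `i` is
in fact inactive and leaves the market. -/
theorem TTCStepWithout.ttcStep {P : H → LinearOrder A} {i : A} {t : A → PrefList H}
    {μ ν : Matching A H} (h : TTCStepWithout P i t μ ν) : TTCStep P t μ ν := by
  obtain ⟨k, c, p, hc, hi, he⟩ := h
  have hmem : ∀ j, c j ∈ activeApplicants t μ := fun j =>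
    Finset.mem_of_mem_insert_of_ne (hc.mem j) (hi j)
  exact ⟨k, c, p, ⟨hc.injective, hmem, hc.applicant_points, fun j =>
    (hc.institution_points j).mono (Finset.subset_insert _ _) (hmem _)⟩, he⟩

theorem TTCStepWithout.inst_self {P : H → LinearOrder A} {i : A} {t : A → PrefList H}
    {μ ν : Matching A H} (h : TTCStepWithout P i t μ ν) : ν.inst i = μ.inst i := by
  obtain ⟨k, c, p, -, hi, he⟩ := h
  exact he.2 i (by rintro ⟨j, hj⟩; exact hi j hj)

/-- Cycles that do not involve `i` depend only on the favorites of the other unmatched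
applicants. -/
theorem TTCStepWithout.of_favorite_eq {P : H → LinearOrder A} {i : A} {t t' : A → PrefList H}
    {μ ν : Matching A H} (h : TTCStepWithout P i t μ ν)
    (ht : ∀ a, a ≠ i → μ.inst a = none →
      favorite (t a) μ.freeInst = favorite (t' a) μ.freeInst) : TTCStepWithout P i t' μ ν := by
  obtain ⟨k, c, p, hc, hi, he⟩ := h
  have hS : insert i (activeApplicants t μ) = insert i (activeApplicants t' μ) := by
    ext a
    by_cases ha : a = i
    · simp [ha]
    · simp only [Finset.mem_insert, ha, false_or, mem_activeApplicants]
      refine and_congr_right fun h => ?_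
      rw [ht a ha h]
  refine ⟨k, c, p, ⟨hc.injective, hS ▸ hc.mem, fun j => ?_, hS ▸ hc.institution_points⟩, hi, he⟩
  have hj := Finset.mem_of_mem_insert_of_ne (hc.mem j) (hi j)
  rw [← ht _ (hi j) (mem_activeApplicants.1 hj).1, hc.applicant_points]

theorem TTCStep.of_favorite_eq {P : H → LinearOrder A} {t t' : A → PrefList H}
    {μ ν : Matching A H} (h : TTCStep P t μ ν)
    (ht : ∀ a, μ.inst a = none → favorite (t a) μ.freeInst = favorite (t' a) μ.freeInst) :
    TTCStep P t' μ ν := by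
  obtain ⟨k, c, p, hc, he⟩ := h
  have hS : activeApplicants t μ = activeApplicants t' μ := by
    ext a
    simp only [mem_activeApplicants]
    refine and_congr_right fun h => ?_
    rw [ht a h]
  refine ⟨k, c, p, ⟨hc.injective, hS ▸ hc.mem, fun j => ?_, hS ▸ hc.institution_points⟩, he⟩
  rw [← ht _ (mem_activeApplicants.1 (hc.mem j)).1, hc.applicant_points]

theorem TTCRunWithout.reflTransGen {P : H → LinearOrder A} {i : A} {t : A → PrefList H}
    {μ : Matching A H} (h : TTCRunWithout P i t μ) :
    Relation.ReflTransGen (TTCStep P t) (Matching.empty A H) μ :=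
  Relation.ReflTransGen.mono (fun _ _ => TTCStepWithout.ttcStep) _ _ h.1

theorem TTCRunWithout.inst_self {P : H → LinearOrder A} {i : A} {t : A → PrefList H}
    {μ : Matching A H} (h : TTCRunWithout P i t μ) : μ.inst i = none := by
  have key : ∀ ν, Relation.ReflTransGen (TTCStepWithout P i t) (Matching.empty A H) ν →
      ν.inst i = none := by
    intro ν hν
    induction hν with
    | refl => rfl
    | tail _ hs ih => rw [hs.inst_self, ih]
  exact key μ h.1

theorem TTCRunWithout.update {P : H → LinearOrder A} {i : A} {t : A → PrefList H}
    {μ : Matching A H} (h : TTCRunWithout P i t μ) (x : PrefList H) :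
    TTCRunWithout P i (Function.update t i x) μ := by
  refine ⟨Relation.ReflTransGen.mono (fun _ _ hs => hs.of_favorite_eq fun a ha _ => ?_) _ _ h.1,
    fun ν hν => h.2 ν (hν.of_favorite_eq fun a ha _ => ?_)⟩ <;>
  rw [Function.update_of_ne ha]

/-- After the cycles that do not involve `i`, applicant `i` gets her favorite remaining
institution. -/
theorem TTCRunWithout.ttc_inst_self {P : H → LinearOrder A} {i : A} {t : A → PrefList H}
    {μ : Matching A H} (h : TTCRunWithout P i t μ) :
    (ttc P t).inst i = favorite (t i) μ.freeInst := by
  cases hf : favorite (t i) μ.freeInst with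
  | none =>
    obtain ⟨ν, hν⟩ := exists_ttcRun P t μ
    rw [← hν.eq_ttc h.reflTransGen]
    suffices key : ∀ ξ, Relation.ReflTransGen (TTCStep P t) μ ξ → ξ.inst i = none from
      key ν hν.1
    intro ξ hξ
    induction hξ with
    | refl => exact h.inst_self
    | @tail η ξ hη hs ih =>
      obtain ⟨k, c, p, hc, he⟩ := hs
      rw [he.2 i, ih]
      rintro ⟨j, hj⟩
      have h1 := (mem_activeApplicants.1 (hc.mem j)).2
      rw [hj] at h1
      exact h1 (favorite_eq_none_mono hf
        (Matching.extends_of_reflTransGen (fun _ _ => TTCStep.extends) hη).freeInst_subset)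
  | some b =>
    have hi : i ∈ activeApplicants t μ := mem_activeApplicants.2 ⟨h.inst_self, by simp [hf]⟩
    obtain ⟨ν, hν⟩ := exists_ttcStep P t μ ⟨i, hi⟩
    have hνi : ν.inst i = some b := by
      obtain ⟨k, c, p, hc, he⟩ := hν
      by_cases hr : i ∈ Set.range c
      · obtain ⟨j, rfl⟩ := hr
        rw [he.1, ← hc.applicant_points, hf]
      -- As `i` is active, inserting her changes nothing, so a cycle missing her would be a step
      -- avoiding `i`, and none is left.
      · refine absurd ?_ (h.2 ν)
        refine ⟨k, c, p, ?_, fun j hj => hr ⟨j, hj⟩, he⟩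
        rwa [Finset.insert_eq_of_mem hi]
    obtain ⟨ξ, hξ⟩ := exists_ttcRun P t ν
    rw [← hξ.eq_ttc (h.reflTransGen.tail hν)]
    exact Matching.extends_of_reflTransGen (fun _ _ => TTCStep.extends) hξ.1 i b hνi

/-- The same `μ` serves for every type of `i`, because the stage that avoids her never consults her
list. -/
theorem menu_ttcOn {P : H → LinearOrder A} {𝒯 : A → Set (PrefList H)} {i : A}
    {t : (a : A) → 𝒯 a} {μ : Matching A H} (h : TTCRunWithout P i (fun a => (t a).1) μ) :
    menu (ttcOn P 𝒯) i t = {o | ∃ l ∈ 𝒯 i, favorite l μ.freeInst = o} := by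
  have key : ∀ x : 𝒯 i,
      (ttcOn P 𝒯 (Function.update t i x)).inst i = favorite x.1 μ.freeInst := by
    intro x
    have hu : (fun a => (Function.update t i x a).1) =
        Function.update (fun a => (t a).1) i x.1 := by
      funext a
      by_cases ha : a = i
      · subst ha; simp
      · simp [ha]
    rw [ttcOn, hu, (h.update x.1).ttc_inst_self, Function.update_self]
  ext o
  constructor
  · rintro ⟨x, rfl⟩
    exact ⟨x.1, x.2, (key x).symm⟩
  · rintro ⟨l, hl, rfl⟩
    exact ⟨⟨l, hl⟩, key _⟩

theorem range_favorite (R : Finset H) :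
    {o | ∃ l ∈ (Set.univ : Set (PrefList H)), favorite l R = o} =
      insert none (some '' (R : Set H)) := by
  ext o
  constructor
  · rintro ⟨l, -, rfl⟩
    cases hf : favorite l R with
    | none => simp
    | some h => exact Or.inr ⟨h, favorite_mem hf, rfl⟩
  · rintro (rfl | ⟨h, hh, rfl⟩)
    · exact ⟨⟨[], List.nodup_nil⟩, trivial, rfl⟩
    · exact ⟨⟨[h], List.nodup_singleton h⟩, trivial, by simpa [favorite] using hh⟩

theorem image_favorite_complete {R : Finset H} (hR : R.Nonempty) :
    {o | ∃ l ∈ {l : PrefList H | ∀ h, h ∈ l.1}, favorite l R = o} = some '' (R : Set H) := by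
  ext o
  constructor
  · rintro ⟨l, hl, rfl⟩
    cases hf : favorite l R with
    | none =>
      obtain ⟨h, hh⟩ := hR
      exact absurd hh (favorite_eq_none_iff.1 hf h (hl h))
    | some h => exact ⟨h, favorite_mem hf, rfl⟩
  · rintro ⟨h, hh, rfl⟩
    refine ⟨⟨h :: (Finset.univ.erase h).toList, ?_⟩, ?_, ?_⟩
    · simp [Finset.nodup_toList]
    · intro b
      by_cases hb : b = h <;> simp [hb]
    · exact List.find?_cons_of_pos (by simpa using hh)

/-- If all institutions were taken, they would inject into the applicants other than `i`. This
excludes "unmatched" from the menu when lists are complete. -/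
theorem Matching.freeInst_nonempty {μ : Matching A H} {i : A} (hi : μ.inst i = none)
    (hcard : Fintype.card A ≤ Fintype.card H) : μ.freeInst.Nonempty := by
  by_contra hne
  rw [Finset.not_nonempty_iff_eq_empty] at hne
  have h1 : ∀ h : H, ∃ a, μ.inst a = some h := by
    intro h
    by_contra hh
    push Not at hh
    simpa [hne] using Matching.mem_freeInst.2 hh
  choose g hg using h1
  have hginj : Function.Injective g := fun a b hab =>
    Option.some.inj ((hg a).symm.trans (hab ▸ hg b))
  have hlt : Fintype.card H < Fintype.card A :=
    Fintype.card_lt_of_injective_of_notMem g hginj (b := i) (by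
      rintro ⟨h, rfl⟩
      simp [hg h] at hi)
  omega

end TTCTheory

/-! ### From streaming algorithms to layered descriptions -/

/-- A procedure that reads the preference lists of the applicants in `A` entry by entry. Its
decisions depend on the time, on the number of entries of each list that have been read, and on
a state in `σ`. -/
structure ListReader (A H σ : Type) where
  start : σ
  /-- The applicant whose next entry is read. -/
  target : ℕ → (A → ℕ) → σ → A
  /-- The state after an entry (`none` if the list has ended) has been read. -/
  update : ℕ → (A → ℕ) → σ → Option H → σ

namespace ListReader

variable {A H σ : Type} [DecidableEq A] (Q : ListReader A H σ)

/-- The numbers of entries read and the state, after a number of steps. -/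
def run (t : A → PrefList H) : ℕ → (A → ℕ) × σ
  | 0 => (fun _ => 0, Q.start)
  | j + 1 =>
    let r := run t j
    let a := Q.target j r.1 r.2
    (fun b => r.1 b + if a = b then 1 else 0, Q.update j r.1 r.2 ((t a).1[r.1 a]?))

theorem run_le (t : A → PrefList H) (j : ℕ) (a : A) : (Q.run t j).1 a ≤ j := by
  induction j with
  | zero => simp [run]
  | succ j ih =>
    simp only [run]
    split_ifs <;> omega

theorem run_succ {t : A → PrefList H} {j : ℕ} {m : A → ℕ} {s : σ} (h : Q.run t j = (m, s)) :
    Q.run t (j + 1) = (fun b => m b + if Q.target j m s = b then 1 else 0,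
      Q.update j m s ((t (Q.target j m s)).1[m (Q.target j m s)]?)) := by
  rw [run, h]

variable [Fintype A] [Fintype σ] (N : ℕ)

/-- The vertices of the description given by `N` steps of a list reader: `none` is the source,
the others consist of a layer, truncated counters, and a state. -/
abbrev Vertex (_ : ListReader A H σ) (N : ℕ) : Type := Option (Fin N × (A → Fin (N + 1)) × σ)

/-- The number of entries read before the vertex `v`. -/
def time : Q.Vertex N → ℕ
  | none => 0
  | some v => v.1 + 1

def counters : Q.Vertex N → A → ℕ
  | none => fun _ => 0
  | some v => fun a => v.2.1 a

def state : Q.Vertex N → σ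
  | none => Q.start
  | some v => v.2.2

theorem time_le (v : Q.Vertex N) : Q.time N v ≤ N := by
  cases v with
  | none => simp [time]
  | some v => exact v.1.2

/-- The vertex with the given data. -/
def mkVertex (j : Fin N) (m : A → ℕ) (s : σ) : Q.Vertex N :=
  some (j, fun a => Fin.ofNat (N + 1) (m a), s)

variable [Nonempty A] [Nonempty σ]

theorem card_vertices_of_time (v : Q.Vertex N) (h : Q.time N v < N) [DecidableEq σ] :
    2 ≤ (Finset.univ.image fun p : (A → Fin (N + 1)) × σ =>
      (some (⟨Q.time N v, h⟩, p) : Q.Vertex N)).card := by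
  rw [Finset.card_image_of_injective _ (by intro p q hpq; simpa using hpq)]
  have : Nontrivial (Fin (N + 1)) := Fin.nontrivial_iff_two_le.2 (by omega)
  have : Nontrivial ((A → Fin (N + 1)) × σ) := inferInstance
  exact Fintype.one_lt_card

open Classical in
/-- The description given by `N` steps of a list reader. -/
noncomputable def description (𝒯 : A → Set (PrefList H)) :
    ExtensiveFormDescription A fun a => 𝒯 a where
  V := Q.Vertex N
  L := N + 1
  layer v := Q.time N v + 1
  layer_mem v := by
    have := Q.time_le N v
    simp only [Finset.mem_Icc]
    omega
  -- Each vertex is joined to the whole next layer, reachable or not. This gives every vertex other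
  -- than the source a predecessor and every querying vertex at least two out-edges.
  succ v := if h : Q.time N v < N then
    Finset.univ.image fun p => some (⟨Q.time N v, h⟩, p) else ∅
  layer_succ v w hw := by
    split_ifs at hw with h
    · obtain ⟨p, -, rfl⟩ := Finset.mem_image.1 hw
      rfl
    · simp at hw
  source := none
  layer_source := rfl
  source_unique v hv := by
    obtain ⟨⟨⟨j, hj⟩, p⟩, rfl⟩ := Option.ne_none_iff_exists'.1 hv
    cases j with
    | zero =>
      refine ⟨none, ?_⟩
      rw [dif_pos (show Q.time N none < N from hj)]
      exact Finset.mem_image.2 ⟨p, Finset.mem_univ _, rfl⟩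
    | succ j =>
      refine ⟨some (⟨j, by omega⟩, p), ?_⟩
      rw [dif_pos (show Q.time N (some (⟨j, by omega⟩, p)) < N from hj)]
      exact Finset.mem_image.2 ⟨p, Finset.mem_univ _, rfl⟩
  query v := if Q.time N v < N then some (Q.target (Q.time N v) (Q.counters N v) (Q.state N v))
    else none
  query_isSome_iff v := by
    by_cases h : Q.time N v < N
    · simpa [h] using Q.card_vertices_of_time N v h
    · simp [h]
  next v a x := if h : Q.time N v < N then
    Q.mkVertex N ⟨Q.time N v, h⟩
      (fun b => Q.counters N v b + if a = b then 1 else 0)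
      (Q.update (Q.time N v) (Q.counters N v) (Q.state N v) (x.1.1[Q.counters N v a]?))
    else v
  next_mem v a ha x := by
    split_ifs at ha with h
    rw [dif_pos h, dif_pos h]
    exact Finset.mem_image.2 ⟨_, Finset.mem_univ _, rfl⟩

variable {𝒯 : A → Set (PrefList H)}

theorem time_of_succ_eq_empty {v : (Q.description N 𝒯).V}
    (hv : (Q.description N 𝒯).succ v = ∅) : Q.time N v = N := by
  classical
  by_contra hne
  have hlt : Q.time N v < N := lt_of_le_of_ne (Q.time_le N v) hne
  have h2 : (Finset.univ.image fun p : (A → Fin (N + 1)) × σ =>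
      (some (⟨Q.time N v, hlt⟩, p) : Q.Vertex N)) = ∅ :=
    (dif_pos hlt).symm.trans hv
  have h3 := Q.card_vertices_of_time N v hlt
  rw [h2] at h3
  simp at h3

/-- The evaluation path tracks the run of the reader, and the stored counters are the true query
counts. This makes the transitions applicant-proposing. -/
theorem visits_description {t : (a : A) → 𝒯 a} {v : (Q.description N 𝒯).V} {m : A → ℕ}
    (hv : (Q.description N 𝒯).Visits t v m) :
    Q.counters N v = m ∧ Q.run (fun a => (t a).1) (Q.time N v) = (m, Q.state N v) := by
  induction hv with
  | source => exact ⟨rfl, rfl⟩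
  | @step v w m _ hs ih =>
    obtain ⟨hw, hq⟩ := hs
    obtain ⟨rfl, hr⟩ := ih
    have hlt : Q.time N v < N := by
      by_contra h
      have hempty : (Q.description N 𝒯).succ v = ∅ := dif_neg h
      simp [hempty] at hw
    have hquery : (Q.description N 𝒯).query v =
        some (Q.target (Q.time N v) (Q.counters N v) (Q.state N v)) := if_pos hlt
    have hrun := Q.run_succ hr
    simp only [hquery, Option.some.injEq]
    have hw' := (hq _ hquery).trans (dif_pos hlt)
    clear hq hw
    subst hw'
    refine ⟨?_, hrun⟩
    funext b
    have hb := Q.run_le (fun a => (t a).1) (Q.time N v + 1) b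
    rw [hrun] at hb
    -- A counter never exceeds the elapsed time, which is at most `N`, so reduction modulo `N + 1`
    -- loses nothing.
    exact Nat.mod_eq_of_lt (Nat.lt_succ_of_le (hb.trans hlt))

theorem exists_visits {ι : Type} {T : ι → Type} [DecidableEq ι]
    {D : ExtensiveFormDescription ι T} {t : (i : ι) → T i} {v : D.V} (hv : D.OnPath t v) :
    ∃ m, D.Visits t v m := by
  induction hv with
  | refl => exact ⟨_, .source⟩
  | tail _ hs ih =>
    obtain ⟨m, hm⟩ := ih
    exact ⟨_, hm.step hs⟩

theorem state_of_onPath {t : (a : A) → 𝒯 a} {v : (Q.description N 𝒯).V}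
    (hv : (Q.description N 𝒯).OnPath t v) :
    Q.state N v = (Q.run (fun a => (t a).1) (Q.time N v)).2 := by
  obtain ⟨m, hm⟩ := exists_visits hv
  rw [(Q.visits_description N hm).2]

theorem isApplicantProposing_description : (Q.description N 𝒯).IsApplicantProposing := by
  intro t v m hv i hi x y hxy
  obtain ⟨hm, -⟩ := Q.visits_description N hv
  by_cases hlt : Q.time N v < N
  · refine (dif_pos hlt).trans (Eq.trans ?_ (dif_pos hlt).symm)
    rw [hm, hxy]
  · have hnext : ∀ z, (Q.description N 𝒯).next v i z = v := fun z => dif_neg hlt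
    rw [hnext, hnext]

theorem memory_description_le :
    (Q.description N 𝒯).memory ≤
      Real.logb 2 ((N + 1 : ℝ) ^ Fintype.card A * Fintype.card σ) := by
  classical
  have hle : ((Finset.Icc 1 (Q.description N 𝒯).L).sup fun j =>
      (Finset.univ.filter fun v => (Q.description N 𝒯).layer v = j).card) ≤
        (N + 1) ^ Fintype.card A * Fintype.card σ := by
    have hcard : Fintype.card ((A → Fin (N + 1)) × σ) =
        (N + 1) ^ Fintype.card A * Fintype.card σ := by simp
    rw [← hcard]
    refine Finset.sup_le fun j _ => ?_
    obtain ⟨p₀⟩ : Nonempty ((A → Fin (N + 1)) × σ) := inferInstance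
    -- The value `p₀` at the source is arbitrary: the source is alone in its layer, so injectivity
    -- there is not at risk.
    let f : Q.Vertex N → (A → Fin (N + 1)) × σ := fun v => v.elim p₀ Prod.snd
    refine Finset.card_le_card_of_injOn (t := Finset.univ) f (fun _ _ => Finset.mem_univ _) ?_
    intro v hv w hw hvw
    have hvj : Q.time N v + 1 = j := (Finset.mem_filter.1 hv).2
    have hwj : Q.time N w + 1 = j := (Finset.mem_filter.1 hw).2
    cases v with
    | none => cases w with
      | none => rfl
      | some w => simp [time] at hvj hwj; omega
    | some v => cases w with
      | none => simp [time] at hvj hwj; omega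
      | some w =>
        simp only [time] at hvj hwj
        exact congrArg some (Prod.ext (Fin.ext (by omega)) hvw)
  have hpos : 0 < ((Finset.Icc 1 (Q.description N 𝒯).L).sup fun j =>
      (Finset.univ.filter fun v => (Q.description N 𝒯).layer v = j).card) := by
    refine lt_of_lt_of_le (Finset.card_pos.2 ⟨(Q.description N 𝒯).source, ?_⟩)
      (Finset.le_sup (f := fun j =>
        (Finset.univ.filter fun v => (Q.description N 𝒯).layer v = j).card) (b := 1)
        (Finset.mem_Icc.2 ⟨le_rfl, Nat.le_add_left 1 N⟩))
    exact Finset.mem_filter.2 ⟨Finset.mem_univ _, (Q.description N 𝒯).layer_source⟩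
  refine Real.logb_le_logb_of_le one_lt_two (by exact_mod_cast hpos) ?_
  exact_mod_cast hle

/-- A list reader gives an individualized dictatorship description of `f` for `i` if it reads
the list of `i` for the first time at time `k`, when the menu is determined by its state, and if
the outcome is determined by its state after `N` steps. -/
theorem isIndividualizedDictatorship_description {f : ((a : A) → 𝒯 a) → Matching A H} {i : A}
    {k : ℕ} (hk : k < N) (hlt : ∀ j < k, ∀ c s, Q.target j c s ≠ i)
    (heq : ∀ c s, Q.target k c s = i) (M : σ → Set (Option H))
    (hM : ∀ t : (a : A) → 𝒯 a, M (Q.run (fun a => (t a).1) k).2 = menu f i t)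
    (label : σ → Matching A H)
    (hlabel : ∀ t : (a : A) → 𝒯 a, label (Q.run (fun a => (t a).1) N).2 = f t) :
    (Q.description N 𝒯).IsIndividualizedDictatorship f i := by
  refine ⟨⟨fun v => label (Q.state N v), fun t v hv hs => ?_⟩, k + 1,
    Finset.mem_Icc.2 ⟨by omega, Nat.succ_le_succ hk.le⟩, fun v hv => ?_, fun v hv => ?_,
    fun v => M (Q.state N v), fun v hv t ht => ?_⟩
  · beta_reduce
    rw [Q.state_of_onPath N hv, Q.time_of_succ_eq_empty N hs, hlabel]
  · have hv' : Q.time N v < k := Nat.lt_of_succ_lt_succ hv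
    exact ⟨_, hlt _ hv' _ _, if_pos (hv'.trans hk)⟩
  · have hv' : Q.time N v = k := Nat.succ_injective hv
    refine (if_pos (hv'.trans_lt hk)).trans ?_
    rw [hv', heq]
  · have hv' : Q.time N v = k := Nat.succ_injective hv
    beta_reduce
    rw [Q.state_of_onPath N ht, hv', hM]

end ListReader

/-! ### Simulating matching steps with little memory -/

section Simulation

variable {A H : Type} [Fintype A] [DecidableEq A] [Fintype H] [DecidableEq H]

/-- The memory of a procedure that simulates Top Trading Cycles: a partial matching, and a part
of the list of each applicant, which is at most one entry for the applicants other than `d`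
and `i`. -/
@[ext] structure SimState (A H : Type) (d i : A) where
  matching : Matching A H
  known : A → PrefList H
  length_known : ∀ a, a ≠ d → a ≠ i → (known a).1.length ≤ 1

/-- The list with the single entry `o`, or the empty list. -/
def PrefList.single (o : Option H) : PrefList H :=
  ⟨o.toList, by cases o <;> simp⟩

/-- Append an entry to a list if the result is a preference list. -/
def PrefList.append (l : PrefList H) (o : Option H) : PrefList H :=
  if h : (l.1 ++ o.toList).Nodup then ⟨_, h⟩ else l

theorem PrefList.append_val {l : PrefList H} {o : Option H} (h : (l.1 ++ o.toList).Nodup) :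
    (l.append o).1 = l.1 ++ o.toList :=
  congrArg Subtype.val (dif_pos h)

theorem PrefList.length_le (l : PrefList H) : l.1.length ≤ Fintype.card H :=
  l.2.length_le_card

namespace SimState

variable {d i : A}

/-- The entries that the state stores. -/
def code (s : SimState A H d i) : ((A → Option H) × (A → Option H)) ×
    ((Fin (Fintype.card H) → Option H) × (Fin (Fintype.card H) → Option H)) :=
  ((s.matching.inst, fun a => (s.known a).1[0]?),
    (fun j => (s.known d).1[j.val]?, fun j => (s.known i).1[j.val]?))

/-- Lists without repetition have at most `Fintype.card H` entries, and all lists except those of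
`d` and `i` are determined by their entry at position 0. -/
theorem code_injective : Function.Injective (code : SimState A H d i → _) := by
  intro s s' h
  simp only [code, Prod.mk.injEq] at h
  obtain ⟨⟨h1, h2⟩, h3, h4⟩ := h
  have full : ∀ l l' : PrefList H, (fun j : Fin (Fintype.card H) => l.1[j.val]?) =
      (fun j : Fin (Fintype.card H) => l'.1[j.val]?) → l = l' := by
    intro l l' h
    refine Subtype.ext (List.ext_getElem? fun j => ?_)
    by_cases hj : j < Fintype.card H
    · exact congrFun h ⟨j, hj⟩
    · rw [List.getElem?_eq_none (by have := l.length_le; omega),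
        List.getElem?_eq_none (by have := l'.length_le; omega)]
  refine SimState.ext (Matching.ext h1) (funext fun a => ?_)
  by_cases hd : a = d
  · subst hd; exact full _ _ h3
  by_cases hi : a = i
  · subst hi; exact full _ _ h4
  refine Subtype.ext (List.ext_getElem? fun j => ?_)
  cases j with
  | zero => exact congrFun h2 a
  | succ j =>
    rw [List.getElem?_eq_none (by have := s.length_known a hd hi; omega),
      List.getElem?_eq_none (by have := s'.length_known a hd hi; omega)]

noncomputable instance : Fintype (SimState A H d i) :=
  Fintype.ofInjective _ code_injective

theorem card_le : Fintype.card (SimState A H d i) ≤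
    (Fintype.card H + 1) ^ (2 * Fintype.card A + 2 * Fintype.card H) := by
  refine (Fintype.card_le_of_injective _ code_injective).trans_eq ?_
  simp only [Fintype.card_prod, Fintype.card_fun, Fintype.card_option, Fintype.card_fin]
  ring

/-- Nothing is known and nobody is matched. -/
def init (d i : A) : SimState A H d i where
  matching := Matching.empty A H
  known := fun _ => ⟨[], List.nodup_nil⟩
  length_known := by simp

/-- Store the entry `o` of the list of `a`. -/
def read (s : SimState A H d i) (a : A) (o : Option H) : SimState A H d i where
  matching := s.matching
  known := Function.update s.known a
    (if a = d ∨ a = i then (s.known a).append o else PrefList.single o)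
  length_known := by
    intro b hd hi
    by_cases hb : b = a
    · subst hb
      rw [Function.update_self, if_neg (by tauto)]
      cases o <;> simp [PrefList.single]
    · simpa [hb] using s.length_known b hd hi

def setMatching (s : SimState A H d i) (μ : Matching A H) : SimState A H d i :=
  { s with matching := μ }

/-- What is stored is the part of the lists read so far, without some institutions that are
matched. -/
def Consistent (t : A → PrefList H) (m : A → ℕ) (s : SimState A H d i) : Prop :=
  ∀ a, ∃ pre, (t a).1.take (m a) = pre ++ (s.known a).1 ∧ ∀ h ∈ pre, h ∉ s.matching.freeInst

theorem consistent_init (t : A → PrefList H) : Consistent t (fun _ => 0) (init d i) :=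
  fun _ => ⟨[], rfl, by simp⟩

theorem Consistent.setMatching {t : A → PrefList H} {m : A → ℕ} {s : SimState A H d i}
    (hs : Consistent t m s) {μ : Matching A H} (hμ : s.matching.Extends μ) :
    Consistent t m (s.setMatching μ) := by
  intro a
  obtain ⟨pre, h1, h2⟩ := hs a
  exact ⟨pre, h1, fun h hh h' => h2 h hh (hμ.freeInst_subset h')⟩

/-- For `d` and `i` the entry is appended, so padding reads are harmless, also past the end of the
list. For the others it overwrites the stored entry, which may move to the discarded prefix because
its institution is taken. -/
theorem Consistent.read {t : A → PrefList H} {m : A → ℕ} {s : SimState A H d i}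
    (hs : Consistent t m s) {a : A}
    (ha : a = d ∨ a = i ∨ favorite (s.known a) s.matching.freeInst = none) :
    Consistent t (fun b => m b + if a = b then 1 else 0) (s.read a ((t a).1[m a]?)) := by
  intro b
  obtain ⟨pre, h1, h2⟩ := hs b
  by_cases hb : a = b
  · subst hb
    have htake : (t a).1.take (m a + 1) =
        pre ++ ((s.known a).1 ++ ((t a).1[m a]?).toList) := by
      rw [List.take_add_one, h1, List.append_assoc]
    simp only [SimState.read, if_true, Function.update_self]
    split_ifs with hdi
    · refine ⟨pre, ?_, h2⟩
      have hnd : ((s.known a).1 ++ ((t a).1[m a]?).toList).Nodup := by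
        have h3 := (t a).2.sublist (List.take_sublist (m a + 1) _)
        rw [htake] at h3
        exact h3.of_append_right
      rw [htake, PrefList.append_val hnd]
    · refine ⟨pre ++ (s.known a).1, by rw [htake, List.append_assoc]; rfl, ?_⟩
      intro h hh
      rcases List.mem_append.1 hh with hh | hh
      · exact h2 h hh
      · have hnone : favorite (s.known a) s.matching.freeInst = none := by tauto
        exact favorite_eq_none_iff.1 hnone h hh
  · refine ⟨pre, ?_, h2⟩
    simp [SimState.read, hb, Ne.symm hb, h1]

/-- The next entry of the list of `a` has to be read in order to know her favorite. -/
def Pending (m : A → ℕ) (s : SimState A H d i) (a : A) : Prop :=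
  a ≠ d ∧ a ≠ i ∧ s.matching.inst a = none ∧ m a < Fintype.card H ∧
    favorite (s.known a) s.matching.freeInst = none

/-- The discarded prefix contains no free institution, so a free stored entry decides the favorite.
Without one, the hypotheses force the list to have been read to its end. -/
theorem Consistent.favorite_known {t : A → PrefList H} {m : A → ℕ} {s : SimState A H d i}
    (hs : Consistent t m s) {a : A} (hp : ¬ Pending m s a) (hμ : s.matching.inst a = none)
    (ha : a = d ∨ a = i → Fintype.card H ≤ m a) :
    favorite (s.known a) s.matching.freeInst = favorite (t a) s.matching.freeInst := by
  obtain ⟨pre, h1, h2⟩ := hs a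
  have hpre : pre.find? (fun h => decide (h ∈ s.matching.freeInst)) = none := by
    simpa [List.find?_eq_none] using h2
  have ht : favorite (t a) s.matching.freeInst =
      (favorite (s.known a) s.matching.freeInst).or
        (((t a).1.drop (m a)).find? fun h => decide (h ∈ s.matching.freeInst)) := by
    conv_lhs => rw [favorite, ← List.take_append_drop (m a) (t a).1]
    rw [h1, List.find?_append, List.find?_append, hpre, Option.none_or]
    rfl
  rw [ht]
  cases hf : favorite (s.known a) s.matching.freeInst with
  | some h => rfl
  | none =>
    have hlen : Fintype.card H ≤ m a := by
      by_contra hlt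
      exact hp ⟨fun h => hlt (ha (.inl h)), fun h => hlt (ha (.inr h)), hμ, by omega, hf⟩
    rw [List.drop_eq_nil_of_le ((t a).length_le.trans hlen)]
    rfl

open Classical in
/-- The applicant whose list is read in a simulation: one of whom the next entry is needed, if
there is one, and `e` otherwise. -/
noncomputable def target (e : A) (m : A → ℕ) (s : SimState A H d i) : A :=
  if h : ∃ a, Pending m s a then h.choose else e

open Classical in
/-- Store the entry that has been read and, unless an entry was needed, make a step of `G`, where
`G` is the kind of step that is simulated. -/
noncomputable def update (G : (A → PrefList H) → Matching A H → Matching A H → Prop) (e : A)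
    (m : A → ℕ) (s : SimState A H d i) (o : Option H) : SimState A H d i :=
  if (∃ a, Pending m s a) ∨ ¬ ∃ ν, G s.known s.matching ν then s.read (target e m s) o
  else (s.read (target e m s) o).setMatching
    (if h : ∃ ν, G s.known s.matching ν then h.choose else s.matching)

/-- The relation `G` consists of steps that match some applicants of `X`, and depends only on
the favorites of the unmatched applicants in `X`. -/
structure IsMatchingStep (G : (A → PrefList H) → Matching A H → Matching A H → Prop)
    (X : Finset A) : Prop where
  of_favorite_eq : ∀ {t t' : A → PrefList H} {μ ν : Matching A H}, G t μ ν →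
    (∀ a ∈ X, μ.inst a = none → favorite (t a) μ.freeInst = favorite (t' a) μ.freeInst) →
    G t' μ ν
  extension : ∀ {t : A → PrefList H} {μ ν : Matching A H}, G t μ ν → μ.Extends ν
  progress : ∀ {t : A → PrefList H} {μ ν : Matching A H}, G t μ ν →
    ∃ a ∈ X, μ.inst a = none ∧ ν.inst a ≠ none

theorem isMatchingStep_ttcStep (P : H → LinearOrder A) :
    IsMatchingStep (TTCStep P) Finset.univ where
  of_favorite_eq h ht := h.of_favorite_eq fun a ha => ht a (Finset.mem_univ _) ha
  extension h := h.extends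
  progress := by
    rintro t μ ν ⟨k, c, p, hc, he⟩
    exact ⟨c 0, Finset.mem_univ _, (mem_activeApplicants.1 (hc.mem 0)).1, by simp [he.1]⟩

theorem isMatchingStep_ttcStepWithout (P : H → LinearOrder A) (i : A) :
    IsMatchingStep (TTCStepWithout P i) (Finset.univ.erase i) where
  of_favorite_eq h ht := h.of_favorite_eq fun a hi ha => ht a (by simp [hi]) ha
  extension h := h.ttcStep.extends
  progress := by
    rintro t μ ν ⟨k, c, p, hc, hi, he⟩
    exact ⟨c 0, by simp [hi 0],
      (mem_activeApplicants.1 (Finset.mem_of_mem_insert_of_ne (hc.mem 0) (hi 0))).1,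
      by simp [he.1]⟩

/-- No entry is needed and no step is possible. -/
def Terminal (G : (A → PrefList H) → Matching A H → Matching A H → Prop) (t : A → PrefList H)
    (m : A → ℕ) (s : SimState A H d i) : Prop :=
  (∀ a, ¬ Pending m s a) ∧ ∀ ν, ¬ G t s.matching ν

/-- A bound on the number of steps until a simulation terminates. -/
def potential (X : Finset A) (m : A → ℕ) (μ : Matching A H) : ℕ :=
  ∑ a ∈ X, ((Fintype.card H - m a) + if μ.inst a = none then 1 else 0)

theorem potential_le (X : Finset A) (m : A → ℕ) (μ : Matching A H) :
    potential X m μ ≤ X.card * (Fintype.card H + 1) := by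
  refine Finset.sum_le_card_nsmul _ _ _ fun a _ => ?_
  split_ifs <;> omega

/-- Both useful actions, reading a needed entry and matching someone in `X`, lower the potential. -/
theorem potential_lt {X : Finset A} {m m' : A → ℕ} {μ μ' : Matching A H}
    (hm : ∀ a, m a ≤ m' a) (hμ : μ.Extends μ')
    (h : ∃ a ∈ X, (m a < Fintype.card H ∧ m a < m' a) ∨
      (μ.inst a = none ∧ μ'.inst a ≠ none)) :
    potential X m' μ' < potential X m μ := by
  have hle : ∀ a, (if μ'.inst a = none then 1 else 0) ≤ (if μ.inst a = none then 1 else 0) := by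
    intro a
    by_cases ha : μ'.inst a = none
    · simp [ha, hμ.inst_eq_none ha]
    · simp [ha]
  refine Finset.sum_lt_sum (fun a _ => ?_) ?_
  · have := hm a
    have := hle a
    omega
  · obtain ⟨a, ha, h⟩ := h
    refine ⟨a, ha, ?_⟩
    have h1 := hm a
    have h2 := hle a
    rcases h with h | ⟨h3, h4⟩
    · omega
    · rw [if_neg h4, if_pos h3]
      omega

theorem target_pending {e : A} {m : A → ℕ} {s : SimState A H d i}
    (h : ∃ a, Pending m s a) : Pending m s (target e m s) := by
  rw [target, dif_pos h]
  exact h.choose_spec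

theorem target_eq {e : A} {m : A → ℕ} {s : SimState A H d i}
    (h : ¬ ∃ a, Pending m s a) : target e m s = e :=
  dif_neg h

/-- A state that is reached from `μ₀` in a simulation of the steps `G`, at most `b` steps before
the end. -/
structure Simulates (G : (A → PrefList H) → Matching A H → Matching A H → Prop) (X : Finset A)
    (t : A → PrefList H) (μ₀ : Matching A H) (b : ℕ) (m : A → ℕ) (s : SimState A H d i) :
    Prop where
  consistent : Consistent t m s
  full : ∀ a ∈ X, a = d ∨ a = i → Fintype.card H ≤ m a
  reachable : Relation.ReflTransGen (G t) μ₀ s.matching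
  progress : Terminal G t m s ∨ potential X m s.matching ≤ b

/-- There are three cases: a needed entry is read; nothing is needed and a step of `G` is made
alongside a padding read of `e`; or neither is possible and the state is terminal. The first two
spend potential, and the last persists. -/
theorem Simulates.step {G : (A → PrefList H) → Matching A H → Matching A H → Prop}
    {X : Finset A} (hG : IsMatchingStep G X) (hX : ∀ a, a ≠ d → a ≠ i → a ∈ X)
    {t : A → PrefList H} {μ₀ : Matching A H} {b : ℕ} {m : A → ℕ} {s : SimState A H d i} {e : A}
    (he : e = d ∨ e = i) (h : Simulates G X t μ₀ (b + 1) m s) :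
    Simulates G X t μ₀ b (fun a => m a + if target e m s = a then 1 else 0)
      (update G e m s ((t (target e m s)).1[m (target e m s)]?)) := by
  have hfull : ∀ a ∈ X, a = d ∨ a = i →
      Fintype.card H ≤ m a + if target e m s = a then 1 else 0 := fun a ha hdi =>
    (h.full a ha hdi).trans (Nat.le_add_right _ _)
  by_cases hp : ∃ a, Pending m s a
  · have ht := target_pending (e := e) hp
    rw [update, if_pos (.inl hp)]
    refine ⟨h.consistent.read (.inr (.inr ht.2.2.2.2)), hfull, h.reachable, .inr ?_⟩
    have h1 : potential X m s.matching ≤ b + 1 :=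
      h.progress.resolve_left fun hT => hT.1 _ ht
    have h2 : potential X (fun a => m a + if target e m s = a then 1 else 0) s.matching <
        potential X m s.matching :=
      potential_lt (fun a => Nat.le_add_right _ _) (fun _ _ h => h)
        ⟨target e m s, hX _ ht.1 ht.2.1, .inl ⟨ht.2.2.2.1, by simp⟩⟩
    exact Nat.le_of_lt_succ (h2.trans_le h1)
  · have hte := target_eq (e := e) hp
    have hread := h.consistent.read (a := target e m s) (by rw [hte]; tauto)
    have hfav : ∀ a ∈ X, s.matching.inst a = none →
        favorite (s.known a) s.matching.freeInst = favorite (t a) s.matching.freeInst :=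
      fun a ha hμ => h.consistent.favorite_known (fun h' => hp ⟨a, h'⟩) hμ (h.full a ha)
    by_cases hs : ∃ ν, G s.known s.matching ν
    · rw [update, if_neg (by tauto), dif_pos hs]
      have hν := hG.of_favorite_eq hs.choose_spec hfav
      generalize hs.choose = ν at hν
      refine ⟨hread.setMatching (hG.extension hν), hfull, h.reachable.tail hν, .inr ?_⟩
      have h1 : potential X m s.matching ≤ b + 1 :=
        h.progress.resolve_left fun hT => hT.2 _ hν
      obtain ⟨a, ha, h3⟩ := hG.progress hν
      have h2 : potential X (fun a => m a + if target e m s = a then 1 else 0) ν <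
          potential X m s.matching :=
        potential_lt (fun a => Nat.le_add_right _ _) (hG.extension hν) ⟨a, ha, .inr h3⟩
      exact Nat.le_of_lt_succ (h2.trans_le h1)
    · rw [update, if_pos (.inr hs)]
      refine ⟨hread, hfull, h.reachable, .inl ⟨fun a ha => hp ⟨a, ?_⟩, fun ν hν => hs ⟨ν, ?_⟩⟩⟩
      · obtain ⟨h1, h2, h3, h4, h5⟩ := ha
        -- The padding read alters only the stored list of `e`, and `e` is `d` or `i`, hence never
        -- pending.
        have hae : a ≠ e := by rintro rfl; tauto
        refine ⟨h1, h2, h3, lt_of_le_of_lt (Nat.le_add_right _ _) h4, ?_⟩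
        simpa [SimState.read, hte, hae] using h5
      · exact hG.of_favorite_eq hν fun a ha hμ => (hfav a ha hμ).symm

/-- If the budget is used up without a terminal state, the potential is zero and everyone in `X` is
matched, so `G` has nobody left to match. -/
theorem Simulates.terminal {G : (A → PrefList H) → Matching A H → Matching A H → Prop}
    {X : Finset A} (hG : IsMatchingStep G X) {t : A → PrefList H} {μ₀ : Matching A H}
    {m : A → ℕ} {s : SimState A H d i} (h : Simulates G X t μ₀ 0 m s) :
    ∀ ν, ¬ G t s.matching ν := by
  rcases h.progress with hT | hz
  · exact hT.2
  · intro ν hν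
    obtain ⟨a, ha, h1, h2⟩ := hG.progress hν
    have := Finset.sum_eq_zero_iff.1 (Nat.le_zero.1 hz) a ha
    simp [h1] at this

/-- A simulation of sufficiently many steps terminates. -/
theorem Simulates.iterate {G : (A → PrefList H) → Matching A H → Matching A H → Prop}
    {X : Finset A} (hG : IsMatchingStep G X) (hX : ∀ a, a ≠ d → a ≠ i → a ∈ X)
    {t : A → PrefList H} {μ₀ : Matching A H} {e : A} (he : e = d ∨ e = i) {K : ℕ}
    {r : ℕ → (A → ℕ) × SimState A H d i} (h₀ : Simulates G X t μ₀ K (r 0).1 (r 0).2)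
    (hr : ∀ j < K, r (j + 1) =
      (fun a => (r j).1 a + if target e (r j).1 (r j).2 = a then 1 else 0,
        update G e (r j).1 (r j).2
          ((t (target e (r j).1 (r j).2)).1[(r j).1 (target e (r j).1 (r j).2)]?))) :
    Simulates G X t μ₀ 0 (r K).1 (r K).2 := by
  suffices key : ∀ j ≤ K, Simulates G X t μ₀ (K - j) (r j).1 (r j).2 by
    simpa using key K le_rfl
  intro j hj
  induction j with
  | zero => exact h₀
  | succ j ih =>
    rw [hr j hj]
    refine Simulates.step hG hX he ?_
    rw [show K - (j + 1) + 1 = K - j by omega]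
    exact ih (by omega)

end SimState

end Simulation

/-! ### The four phases of the TTC reader -/

section TTCReader

variable {A H : Type} [Fintype A] [DecidableEq A] [Fintype H] [DecidableEq H]

namespace TTCReader

/-- The time at which the list of the auxiliary applicant has been read. -/
def auxiliaryTime (A H : Type) [Fintype A] [Fintype H] : ℕ :=
  -- The first factor makes this zero when `i` is the only applicant, where no other applicant could
  -- be queried. Otherwise there are at least enough reads for a complete list, and surplus reads
  -- return `none`.
  (Fintype.card A - 1) * Fintype.card H

/-- The time at which all cycles that do not involve the dictator have been executed. -/
def menuTime (A H : Type) [Fintype A] [Fintype H] : ℕ :=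
  auxiliaryTime A H + (Fintype.card A - 1) * (Fintype.card H + 1)

/-- The time at which the list of the dictator has been read. -/
def dictatorTime (A H : Type) [Fintype A] [Fintype H] : ℕ :=
  menuTime A H + Fintype.card H

def finalTime (A H : Type) [Fintype A] [Fintype H] : ℕ :=
  dictatorTime A H + Fintype.card A * (Fintype.card H + 1)

end TTCReader

open TTCReader

/-- Top Trading Cycles as a list reader: the list of `d` is read, the cycles that do not involve
`i` are executed, the list of `i` is read, and the remaining cycles are executed. After their lists
have been read, `d` and `i` are read on whenever no entry of another list is needed. -/
noncomputable def ttcReader (P : H → LinearOrder A) (d i : A) :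
    ListReader A H (SimState A H d i) where
  start := SimState.init d i
  target j m s :=
    if j < auxiliaryTime A H then d
    else if j < menuTime A H then SimState.target d m s
    else if j < dictatorTime A H then i
    else SimState.target i m s
  update j m s o :=
    if j < auxiliaryTime A H then s.read d o
    else if j < menuTime A H then SimState.update (TTCStepWithout P i) d m s o
    else if j < dictatorTime A H then s.read i o
    else SimState.update (TTCStep P) i m s o

namespace TTCReader

variable {P : H → LinearOrder A} {d i : A} {t : A → PrefList H}

theorem menuTime_lt_dictatorTime [Nonempty H] : menuTime A H < dictatorTime A H :=
  Nat.lt_add_of_pos_right Fintype.card_pos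

/-- With a single applicant `menuTime` is zero and the claim is vacuous. Otherwise padding goes to
`d`, and a pending applicant is never `i`. -/
theorem target_ne (hd : d ≠ i ∨ Fintype.card A = 1) {j : ℕ} (hj : j < menuTime A H)
    (m : A → ℕ) (s : SimState A H d i) : (ttcReader P d i).target j m s ≠ i := by
  have hd : d ≠ i := hd.resolve_right fun h => by simp [menuTime, auxiliaryTime, h] at hj
  simp only [ttcReader, if_pos hj]
  split_ifs
  · exact hd
  · by_cases hp : ∃ a, SimState.Pending m s a
    · exact (SimState.target_pending hp).2.1
    · rwa [SimState.target_eq hp]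

theorem target_menuTime [Nonempty H] (m : A → ℕ) (s : SimState A H d i) :
    (ttcReader P d i).target (menuTime A H) m s = i := by
  have h1 : ¬ menuTime A H < auxiliaryTime A H := by simp [menuTime]
  simp only [ttcReader, if_neg h1, lt_irrefl, if_false, if_pos menuTime_lt_dictatorTime]

theorem run_auxiliaryTime : ∀ j ≤ auxiliaryTime A H,
    SimState.Consistent t ((ttcReader P d i).run t j).1 ((ttcReader P d i).run t j).2 ∧
      ((ttcReader P d i).run t j).2.matching = Matching.empty A H ∧
      ((ttcReader P d i).run t j).1 d = j := by
  intro j hj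
  induction j with
  | zero => exact ⟨SimState.consistent_init t, rfl, rfl⟩
  | succ j ih =>
    obtain ⟨h1, h2, h3⟩ := ih (by omega)
    have hlt : j < auxiliaryTime A H := hj
    have hrun := (ttcReader P d i).run_succ (t := t) (j := j) rfl
    simp only [ttcReader, if_pos hlt] at hrun
    simp only [ttcReader] at h1 h2 h3 ⊢
    rw [hrun]
    exact ⟨h1.read (.inl rfl), h2, by simp [h3]⟩

theorem simulates_menuTime (hd : d ≠ i ∨ Fintype.card A = 1) :
    SimState.Simulates (TTCStepWithout P i) (Finset.univ.erase i) t (Matching.empty A H) 0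
      ((ttcReader P d i).run t (menuTime A H)).1 ((ttcReader P d i).run t (menuTime A H)).2 := by
  refine SimState.Simulates.iterate
    (r := fun j => (ttcReader P d i).run t (auxiliaryTime A H + j))
    (SimState.isMatchingStep_ttcStepWithout P i) (fun a _ hi => by simp [hi]) (.inl rfl)
    (K := (Fintype.card A - 1) * (Fintype.card H + 1)) ?_ ?_
  · obtain ⟨h1, h2, h3⟩ := run_auxiliaryTime (P := P) (d := d) (i := i) (t := t)
      (auxiliaryTime A H) le_rfl
    refine ⟨h1, ?_, ?_, .inr ((SimState.potential_le _ _ _).trans ?_)⟩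
    · intro a ha hdi
      obtain rfl : a = d := hdi.resolve_right (Finset.ne_of_mem_erase ha)
      change _ ≤ ((ttcReader P a i).run t (auxiliaryTime A H)).1 a
      rw [h3]
      -- With a second applicant the auxiliary phase has at least `Fintype.card H` reads, so the
      -- list of `d` is known in full.
      have : 1 < Fintype.card A :=
        Fintype.one_lt_card_iff.2 ⟨a, i, Finset.ne_of_mem_erase ha⟩
      exact Nat.le_mul_of_pos_left _ (by omega)
    · change Relation.ReflTransGen _ _ ((ttcReader P d i).run t (auxiliaryTime A H)).2.matching
      rw [h2]
    · rw [Finset.card_erase_of_mem (Finset.mem_univ i), Finset.card_univ]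
  · intro j hj
    have h1 : ¬ auxiliaryTime A H + j < auxiliaryTime A H := by omega
    have h2 : auxiliaryTime A H + j < menuTime A H := by rw [menuTime]; omega
    have hrun := (ttcReader P d i).run_succ (t := t) (j := auxiliaryTime A H + j) rfl
    simp only [ttcReader, if_neg h1, if_pos h2] at hrun
    exact hrun

/-- At `menuTime`, all cycles that do not involve `i` have been executed. -/
theorem ttcRunWithout_menuTime (hd : d ≠ i ∨ Fintype.card A = 1) :
    TTCRunWithout P i t ((ttcReader P d i).run t (menuTime A H)).2.matching :=
  ⟨(simulates_menuTime hd).reachable,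
    (simulates_menuTime hd).terminal (SimState.isMatchingStep_ttcStepWithout P i)⟩

/-- Reading the list of `i` leaves the matching alone. Monotone counters preserve the fact that `d`
has been read completely. -/
theorem run_dictatorTime : ∀ j ≤ Fintype.card H,
    SimState.Consistent t ((ttcReader P d i).run t (menuTime A H)).1
      ((ttcReader P d i).run t (menuTime A H)).2 →
    SimState.Consistent t ((ttcReader P d i).run t (menuTime A H + j)).1
      ((ttcReader P d i).run t (menuTime A H + j)).2 ∧
    ((ttcReader P d i).run t (menuTime A H + j)).2.matching =
      ((ttcReader P d i).run t (menuTime A H)).2.matching ∧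
    j ≤ ((ttcReader P d i).run t (menuTime A H + j)).1 i ∧
    ∀ a, ((ttcReader P d i).run t (menuTime A H)).1 a ≤
      ((ttcReader P d i).run t (menuTime A H + j)).1 a := by
  intro j hj h₀
  induction j with
  | zero => exact ⟨h₀, rfl, Nat.zero_le _, fun _ => le_rfl⟩
  | succ j ih =>
    obtain ⟨h1, h2, h3, h4⟩ := ih (by omega)
    have e1 : ¬ menuTime A H + j < auxiliaryTime A H := by rw [menuTime]; omega
    have e2 : ¬ menuTime A H + j < menuTime A H := by omega
    have e3 : menuTime A H + j < dictatorTime A H := by rw [dictatorTime]; omega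
    have hrun : (ttcReader P d i).run t (menuTime A H + (j + 1)) = _ :=
      (ttcReader P d i).run_succ (t := t) (j := menuTime A H + j) rfl
    have ht : ∀ m s, (ttcReader P d i).target (menuTime A H + j) m s = i := fun m s => by
      simp only [ttcReader, if_neg e1, if_neg e2, if_pos e3]
    have hu : ∀ m s o, (ttcReader P d i).update (menuTime A H + j) m s o = s.read i o :=
      fun m s o => by simp only [ttcReader, if_neg e1, if_neg e2, if_pos e3]
    simp only [ht, hu] at hrun
    rw [hrun]
    refine ⟨h1.read (.inr (.inl rfl)), h2, by simpa using h3, fun a => ?_⟩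
    exact (h4 a).trans (Nat.le_add_right _ _)

/-- At `finalTime`, all cycles have been executed. -/
theorem ttcRun_finalTime (hd : d ≠ i ∨ Fintype.card A = 1) :
    TTCRun P t ((ttcReader P d i).run t (menuTime A H)).2.matching
      ((ttcReader P d i).run t (finalTime A H)).2.matching := by
  have hsim := simulates_menuTime (P := P) (t := t) hd
  obtain ⟨h1, h2, h3, h4⟩ := run_dictatorTime (P := P) (d := d) (i := i) (t := t)
    (Fintype.card H) le_rfl hsim.consistent
  have hfinal : SimState.Simulates (TTCStep P) Finset.univ t
      ((ttcReader P d i).run t (menuTime A H)).2.matching 0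
      ((ttcReader P d i).run t (finalTime A H)).1
      ((ttcReader P d i).run t (finalTime A H)).2 := by
    refine SimState.Simulates.iterate
      (r := fun j => (ttcReader P d i).run t (dictatorTime A H + j))
      (SimState.isMatchingStep_ttcStep P) (fun a _ _ => Finset.mem_univ a) (.inr rfl)
      (K := Fintype.card A * (Fintype.card H + 1)) ?_ ?_
    · refine ⟨h1, ?_, ?_, .inr (SimState.potential_le _ _ _)⟩
      · intro a _ hdi
        by_cases ha : a = i
        · subst ha
          exact h3
        · exact (hsim.full a (by simp [ha]) hdi).trans (h4 a)
      · change Relation.ReflTransGen _ _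
          ((ttcReader P d i).run t (menuTime A H + Fintype.card H)).2.matching
        rw [h2]
    · intro j hj
      have e3 : ¬ dictatorTime A H + j < dictatorTime A H := by omega
      have e2 : ¬ dictatorTime A H + j < menuTime A H := by rw [dictatorTime]; omega
      have e1 : ¬ dictatorTime A H + j < auxiliaryTime A H := by
        rw [dictatorTime, menuTime]; omega
      have hrun := (ttcReader P d i).run_succ (t := t) (j := dictatorTime A H + j) rfl
      simp only [ttcReader, if_neg e1, if_neg e2, if_neg e3] at hrun
      exact hrun
  refine ⟨hfinal.reachable, ?_⟩
  by_contra hne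
  obtain ⟨ν, hν⟩ := exists_ttcStep P t _ (Finset.nonempty_iff_ne_empty.2 hne)
  exact hfinal.terminal (SimState.isMatchingStep_ttcStep P) ν hν

end TTCReader

/-- Top Trading Cycles has an applicant-proposing individualized dictatorship description, whose
memory is quasilinear. -/
theorem exists_ttcDescription [Nonempty H] (𝒯 : A → Set (PrefList H)) (P : H → LinearOrder A)
    (i : A) : ∃ D : ExtensiveFormDescription A fun a => 𝒯 a,
      D.IsIndividualizedDictatorship (ttcOn P 𝒯) i ∧ D.IsApplicantProposing ∧
        D.memory ≤ Real.logb 2 (((finalTime A H + 1) ^ Fintype.card A *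
          (Fintype.card H + 1) ^ (2 * Fintype.card A + 2 * Fintype.card H) : ℕ) : ℝ) := by
  obtain ⟨d, hd⟩ : ∃ d : A, d ≠ i ∨ Fintype.card A = 1 := by
    by_cases h : ∃ d : A, d ≠ i
    · exact h.imp fun _ => .inl
    · push Not at h
      exact ⟨i, .inr (Fintype.card_eq_one_iff.2 ⟨i, h⟩)⟩
  have : Nonempty A := ⟨i⟩
  have : Nonempty (SimState A H d i) := ⟨SimState.init d i⟩
  refine ⟨(ttcReader P d i).description (finalTime A H) 𝒯, ?_,
    ListReader.isApplicantProposing_description _ _,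
    (ListReader.memory_description_le _ _).trans ?_⟩
  · refine ListReader.isIndividualizedDictatorship_description _ _ (k := menuTime A H)
      (menuTime_lt_dictatorTime.trans_le (Nat.le_add_right _ _))
      (fun j hj m s => target_ne hd hj m s) target_menuTime
      (fun s => {o | ∃ l ∈ 𝒯 i, favorite l s.matching.freeInst = o}) (fun t => ?_)
      (fun s => s.matching) fun t => ?_
    · exact (menu_ttcOn (ttcRunWithout_menuTime hd)).symm
    · exact (ttcRun_finalTime hd).eq_ttc (ttcRunWithout_menuTime hd).reflTransGen
  · refine Real.logb_le_logb_of_le one_lt_two ?_ ?_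
    · have : 0 < Fintype.card (SimState A H d i) := Fintype.card_pos
      positivity
    · exact_mod_cast Nat.mul_le_mul_left _ SimState.card_le

end TTCReader

/-! ### Memory estimate and conclusion -/

theorem finalTime_le (n : ℕ) (hn : 0 < n) :
    TTCReader.finalTime (Fin n) (Fin n) + 1 ≤ (n + 1) ^ 3 := by
  obtain ⟨k, rfl⟩ := Nat.exists_eq_succ_of_ne_zero hn.ne'
  simp only [TTCReader.finalTime, TTCReader.dictatorTime, TTCReader.menuTime,
    TTCReader.auxiliaryTime, Fintype.card_fin, Nat.succ_eq_add_one, Nat.add_sub_cancel]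
  nlinarith [Nat.zero_le (k ^ 3), Nat.zero_le (k ^ 2)]

theorem isSoftO_memoryBound :
    IsSoftO (fun n => 7 * n * Real.logb 2 (n + 1)) fun n => (n : ℝ) := by
  -- The constant is 7 times 2, the factor 2 coming from n + 1 ≤ n² for n ≥ 2; the division changes
  -- the base of the logarithm.
  refine ⟨1, Asymptotics.IsBigO.of_bound (14 / Real.log 2) ?_⟩
  filter_upwards [Filter.eventually_ge_atTop 2] with n hn
  have hn' : (2 : ℝ) ≤ n := by exact_mod_cast hn
  have hlog : Real.log (n + 1) ≤ 2 * Real.log n := by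
    rw [← Real.log_rpow (by linarith)]
    refine Real.log_le_log (by linarith) ?_
    rw [Real.rpow_two]
    nlinarith
  have h2 : 0 < Real.log 2 := Real.log_pos one_lt_two
  have hn0 : 0 ≤ Real.log (n + 1) := Real.log_nonneg (by linarith)
  have hn1 : 0 ≤ Real.log n := Real.log_nonneg (by linarith)
  rw [Real.norm_of_nonneg (by rw [Real.logb]; positivity), Real.norm_of_nonneg (by positivity),
    Real.logb, pow_one]
  calc 7 * (n : ℝ) * (Real.log (n + 1) / Real.log 2)
      = 7 * n / Real.log 2 * Real.log (n + 1) := by ring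
    _ ≤ 7 * n / Real.log 2 * (2 * Real.log n) := by gcongr
    _ = 14 / Real.log 2 * (n * Real.log n) := by ring

theorem theorem2 :
    -- the applicant-linear individualized dictatorship descriptions
    (∃ B : ℕ → ℝ, IsSoftO B (fun n => (n : ℝ)) ∧
      ∀ (n : ℕ) (𝒯 : Fin n → Set (PrefList (Fin n))) (P : Fin n → LinearOrder (Fin n))
        (i : Fin n),
        ∃ D : ExtensiveFormDescription (Fin n) fun a => 𝒯 a,
          D.IsIndividualizedDictatorship (ttcOn P 𝒯) i ∧ D.IsApplicantProposing ∧
            D.memory ≤ B n) ∧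
    -- the menu, and the completion of the matching
    (∀ (n : ℕ) (𝒯 : Fin n → Set (PrefList (Fin n))) (P : Fin n → LinearOrder (Fin n))
      (i : Fin n) (t : (a : Fin n) → 𝒯 a) (μ : Matching (Fin n) (Fin n)),
      TTCRunWithout P i (fun a => (t a).1) μ →
        menu (ttcOn P 𝒯) i t = {o | ∃ l ∈ 𝒯 i, favorite l μ.freeInst = o} ∧
        (𝒯 i = Set.univ →
          menu (ttcOn P 𝒯) i t = insert none (some '' (μ.freeInst : Set (Fin n)))) ∧
        (𝒯 i = {l | ∀ h, h ∈ l.1} →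
          menu (ttcOn P 𝒯) i t = some '' (μ.freeInst : Set (Fin n))) ∧
        ∀ ν, TTCRun P (fun a => (t a).1) μ ν → ν = ttcOn P 𝒯 t) := by
  refine ⟨⟨_, isSoftO_memoryBound, fun n 𝒯 P i => ?_⟩, fun n 𝒯 P i t μ hμ => ?_⟩
  · have hn : 0 < n := i.pos
    have : Nonempty (Fin n) := ⟨i⟩
    obtain ⟨D, h1, h2, h3⟩ := exists_ttcDescription 𝒯 P i
    refine ⟨D, h1, h2, h3.trans ?_⟩
    -- In the exponent 7n, the counters account for 3n by the cubic time bound, and the state for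
    -- 4n: the matching, the current entries and two full lists.
    have hle : (TTCReader.finalTime (Fin n) (Fin n) + 1) ^ Fintype.card (Fin n) *
        (Fintype.card (Fin n) + 1) ^ (2 * Fintype.card (Fin n) + 2 * Fintype.card (Fin n)) ≤
          (n + 1) ^ (7 * n) := by
      simp only [Fintype.card_fin]
      calc _ ≤ ((n + 1) ^ 3) ^ n * (n + 1) ^ (2 * n + 2 * n) :=
            Nat.mul_le_mul_right _ (Nat.pow_le_pow_left (finalTime_le n hn) n)
        _ = _ := by rw [← pow_mul, ← pow_add]; congr 1; ring
    have hlog : Real.logb 2 (((n + 1) ^ (7 * n) : ℕ) : ℝ) =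
        7 * n * Real.logb 2 (n + 1) := by
      push_cast
      rw [Real.logb_pow]
      push_cast
      ring
    rw [← hlog]
    exact Real.logb_le_logb_of_le one_lt_two (Nat.cast_pos.2 (by positivity))
      (Nat.cast_le.2 hle)
  · refine ⟨menu_ttcOn hμ, fun h => ?_, fun h => ?_, fun ν hν => hν.eq_ttc hμ.reflTransGen⟩
    · rw [menu_ttcOn hμ, h, range_favorite]
    · rw [menu_ttcOn hμ, h, image_favorite_complete]
      exact Matching.freeInst_nonempty hμ.inst_self le_rfl
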